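/- Let $L$ be an oriented link diagram in the plane with $n$ crossings, $n_-$ of them negative, and let $p$ be a basepoint on $L$ away from the crossings. For $\alpha\in\{0,1\}^n$ let $D_\alpha$ be the collection of circles obtained by resolving each crossing $j$ by its $\alpha_j$-resolution. A labelled resolution is a vertex $\alpha$ together with a labelling of each circle of $D_\alpha$ by $\mathbf 1$ or $x$. For $i\in\mathbb Z$ let $C_i$ be the $\mathbb F_2$-vector space with basis the labelled resolutions for which $\alpha$ has exactly $i+n_-$ entries equal to $1$. Let $d,h:C_i\to C_{i+1}$ be the sums, over all edges $\alpha\to\beta$ of the cube (one coordinate changes from $0$ to $1$), of the maps that keep the labels of all circles not touching the changed crossing and act on the other circles as follows. If two circles merge, $d$ acts by $m$ and $h$ by $m'$, where $$m(\mathbf 1\otimes\mathbf 1)=\mathbf 1,\quad m(\mathbf 1\otimes x)=m(x\otimes\mathbf 1)=x,\quad m(x\otimes x)=0,\qquad m'(x\otimes x)=x,$$ and $m'$ is $0$ on the other basis vectors. If a circle splits, $d$ acts by $\Delta$ and $h$ by $\Delta'$, where $$\Delta(\mathbf 1)=\mathbf 1\otimes x+x\otimes\mathbf 1,\quad \Delta(x)=x\otimes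 x,\qquad \Delta'(\mathbf 1)=\mathbf 1\otimes\mathbf 1,\quad \Delta'(x)=0.$$ The Bar-Natan complex is the complex of $\mathbb F_2[H]$-modules $\mathcal C_{BN}=(C_*[H],\,d+Hh)$. Let $\mathcal C_x$ and $\mathcal C_1$ be the submodules of $\mathcal C_{BN}$ spanned by the labelled resolutions in which the circle through $p$ is labelled $x$, respectively $\mathbf 1$. Then $\mathcal C_x$ is a subcomplex, and $\mathcal C_1\cong\mathcal C_{BN}/\mathcal C_x$ is a complex whose differential is $d+Hh$ followed by the projection onto $\mathcal C_1$. **Theorem.** For every $i\in\mathbb Z$ there is an isomorphism of $\mathbb F_2[H]$-modules $$H_i(\mathcal C_{BN})\;\cong\;H_i(\mathcal C_x)\oplus H_i(\mathcal C_1).$$ -/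

import Mathlib

open Polynomial

/-- An oriented link diagram in the plane, as a combinatorial map.
There are `n` crossings.  The four half-edges at the crossing `c` are `(c, 0), (c, 1), (c, 2), (c, 3)`
in counterclockwise order; `(c, 0), (c, 2)` form the under-strand and `(c, 1), (c, 3)` the
over-strand.  `pair` matches the two half-edges of each arc between crossings.
`loops` is the number of components that are simple closed curves without crossings.
`out d` says that the orientation points away from the crossing along the half-edge `d`
(orientations of the crossingless components never matter and are not recorded).
`planar` is Euler's formula `V - E + F = 2 c` with `V = n` and `E = 2 n`, where the faces are
the cycles of the face permutation and `c` counts the connected components of the underlying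
4-valent graph; it says that every component has genus zero. -/
structure LinkDiagram where
  n : ℕ
  loops : ℕ
  pair : Equiv.Perm (Fin n × Fin 4)
  pair_pair : ∀ d, pair (pair d) = d
  pair_ne : ∀ d, pair d ≠ d
  out : Fin n × Fin 4 → Bool
  out_pair : ∀ d, out (pair d) = !out d
  out_opposite : ∀ c k, out (c, k + 2) = !out (c, k)
  planar :
    Nat.card (Quot fun d e : Fin n × Fin 4 => e = ((pair d).1, (pair d).2 + 1)) =
      n + 2 * Nat.card (Quot fun d e : Fin n × Fin 4 => e = pair d ∨ e = (d.1, d.2 + 1))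

/-- The two labels of a circle. -/
inductive Label
  | one
  | x
  deriving DecidableEq

namespace Label

/-- `mul a b c` is the coefficient of `c` in `m (a ⊗ b)`. -/
def mul : Label → Label → Label → ZMod 2
  | one, one, one => 1
  | one, x, x => 1
  | x, one, x => 1
  | _, _, _ => 0

/-- `comul a b c` is the coefficient of `b ⊗ c` in `Δ a`. -/
def comul : Label → Label → Label → ZMod 2
  | one, one, x => 1
  | one, x, one => 1
  | x, x, x => 1
  | _, _, _ => 0

/-- `mul' a b c` is the coefficient of `c` in `m' (a ⊗ b)`. -/
def mul' : Label → Label → Label → ZMod 2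
  | x, x, x => 1
  | _, _, _ => 0

/-- `comul' a b c` is the coefficient of `b ⊗ c` in `Δ' a`. -/
def comul' : Label → Label → Label → ZMod 2
  | one, one, one => 1
  | _, _, _ => 0

end Label

/-- The homology `ker g / im f` in the middle of a complex `A → B → C` with maps `f` and `g`
(the image is intersected with the kernel, which changes nothing as `g ∘ f = 0` in a complex). -/
abbrev MiddleHomology {R A B C : Type*} [CommRing R] [AddCommGroup A] [AddCommGroup B]
    [AddCommGroup C] [Module R A] [Module R B] [Module R C] (f : A →ₗ[R] B) (g : B →ₗ[R] C) :
    Type _ :=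
  LinearMap.ker g ⧸ (LinearMap.range f).comap (LinearMap.ker g).subtype

namespace LinkDiagram

variable (D : LinkDiagram)

/-- A crossing is negative when it is not positive; with the conventions above a crossing is
positive exactly when the orientation leaves it through both of `1, 2` or through none of them. -/
noncomputable def negCrossings : ℕ := Nat.card {c : Fin D.n // D.out (c, 1) ≠ D.out (c, 2)}

/-- Positions on the diagram away from the crossings: a half-edge (the two half-edges
of an arc stand for the same arc) or a crossingless component. -/
abbrev Point : Type := (Fin D.n × Fin 4) ⊕ Fin D.loops

/-- How a resolution joins the four half-edges of a crossing: the `0`-resolution (`false`) joins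
`0` with `1` and `2` with `3`; the `1`-resolution (`true`) joins `0` with `3` and `1` with `2`. -/
def resolve : Bool → Fin 4 → Fin 4
  | false => ![1, 0, 3, 2]
  | true => ![3, 2, 1, 0]

/-- Direct adjacency of positions in the full resolution given by the hypercube vertex `α`. -/
inductive Joined (α : Fin D.n → Bool) : D.Point → D.Point → Prop
  | arc (d : Fin D.n × Fin 4) : Joined α (Sum.inl d) (Sum.inl (D.pair d))
  | crossing (c : Fin D.n) (k : Fin 4) :
      Joined α (Sum.inl (c, k)) (Sum.inl (c, resolve (α c) k))

/-- The circles of the full resolution at `α`. -/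
def Circle (α : Fin D.n → Bool) : Type := Quot (D.Joined α)

/-- The circle through a given position. -/
def circle (α : Fin D.n → Bool) (p : D.Point) : D.Circle α := Quot.mk _ p

instance (α : Fin D.n → Bool) : Finite (D.Circle α) :=
  inferInstanceAs (Finite (Quot (D.Joined α)))

instance : Finite Label :=
  Finite.of_injective (fun a : Label => decide (a = Label.x)) (by
    intro a b h; cases a <;> cases b <;> simp_all)

/-- The standard basis vectors of all `V_α`: a full resolution with labelled circles. -/
abbrev State : Type := Σ α : Fin D.n → Bool, (D.Circle α → Label)

/-- The Hamming weight of a hypercube vertex. -/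
def weight (α : Fin D.n → Bool) : ℕ := (Finset.univ.filter fun j => α j = true).card

/-- The standard basis of the chain group in homological degree `i`. -/
abbrev Gen (i : ℤ) : Type := {s : D.State // (D.weight s.1 : ℤ) = i + D.negCrossings}

noncomputable instance (i : ℤ) : Fintype (D.Gen i) := Fintype.ofFinite _

open Classical in
/-- The matrix entry from `s` to `t` of the edge map that changes the crossing `j` from its `0`- to
its `1`-resolution, formed from a merge map `μ` and a split map `δ`.  The positions
`(j, 0)` and `(j, 2)` lie on the two different strands of either resolution of `j`.
The circles that do not touch the crossing `j` keep their labels.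
The first case is a merge (two circles become one) and the second a split (one circle becomes two);
for a planar diagram, every edge of the hypercube is one of the two. -/
noncomputable def edgeCoeff (μ δ : Label → Label → Label → ZMod 2) (j : Fin D.n)
    (s t : D.State) : ZMod 2 :=
  let a : D.Point := Sum.inl (j, 0)
  let b : D.Point := Sum.inl (j, 2)
  if s.1 j = false ∧ t.1 = Function.update s.1 j true ∧
      ∀ p : D.Point, D.circle s.1 p ≠ D.circle s.1 a → D.circle s.1 p ≠ D.circle s.1 b →
        t.2 (D.circle t.1 p) = s.2 (D.circle s.1 p) then
    if D.circle s.1 a ≠ D.circle s.1 b ∧ D.circle t.1 a = D.circle t.1 b then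
      μ (s.2 (D.circle s.1 a)) (s.2 (D.circle s.1 b)) (t.2 (D.circle t.1 a))
    else if D.circle s.1 a = D.circle s.1 b ∧ D.circle t.1 a ≠ D.circle t.1 b then
      δ (s.2 (D.circle s.1 a)) (t.2 (D.circle t.1 a)) (t.2 (D.circle t.1 b))
    else 0
  else 0

/-- Matrix entries of the Khovanov differential `d`. -/
noncomputable def dCoeff (s t : D.State) : ZMod 2 :=
  ∑ j, D.edgeCoeff Label.mul Label.comul j s t

/-- Matrix entries of the perturbation `h`. -/
noncomputable def hCoeff (s t : D.State) : ZMod 2 :=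
  ∑ j, D.edgeCoeff Label.mul' Label.comul' j s t

/-- The chain group `C_i[H]` of the Bar-Natan complex: the free `𝔽₂[H]`-module on the finite set
of labelled resolutions in degree `i`. The polynomial variable is `H`. -/
abbrev Chain (i : ℤ) : Type := D.Gen i → (ZMod 2)[X]

/-- The Bar-Natan differential `d + H h`, as a map from degree `i` to degree `j`
(it is zero unless `j = i + 1`). -/
noncomputable def diff (i j : ℤ) : D.Chain i →ₗ[(ZMod 2)[X]] D.Chain j :=
  Matrix.mulVecLin (Matrix.of fun (t : D.Gen j) (s : D.Gen i) =>
    C (D.dCoeff s.1 t.1) + X * C (D.hCoeff s.1 t.1))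

/-- The Bar-Natan homology in degree `i`. -/
abbrev BN (i : ℤ) : Type := MiddleHomology (D.diff (i - 1) i) (D.diff i (i + 1))

/-- The part of the chain group spanned by the labelled resolutions
in which the circle through the basepoint `p` is labelled `a`. -/
def Part (p : D.Point) (a : Label) (i : ℤ) : Submodule (ZMod 2)[X] (D.Chain i) where
  carrier := {v | ∀ s : D.Gen i, s.1.2 (D.circle s.1.1 p) ≠ a → v s = 0}
  zero_mem' := fun _ _ => rfl
  add_mem' := fun hv hw s hs => by simp [hv s hs, hw s hs]
  smul_mem' := fun r v hv s hs => by simp [hv s hs]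

/-- The projection of the chain group onto `Part p a i` that discards all labelled
resolutions in which the circle through `p` is not labelled `a`. -/
noncomputable def proj (p : D.Point) (a : Label) (i : ℤ) : D.Chain i →ₗ[(ZMod 2)[X]] D.Part p a i where
  toFun v := ⟨fun s => if s.1.2 (D.circle s.1.1 p) = a then v s else 0,
    fun _ hs => if_neg hs⟩
  map_add' v w := by
    ext1; funext s
    by_cases h : s.1.2 (D.circle s.1.1 p) = a <;> simp [h]
  map_smul' r v := by
    ext1; funext s
    by_cases h : s.1.2 (D.circle s.1.1 p) = a <;> simp [h]

/-- The differential of the reduced complex `C_a` (`a` is `1` or `x`): apply `d + H h`, then project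
back to `C_a`.  For `a = x` the projection changes nothing, by `diff_mem_part_x` below. -/
noncomputable def redDiff (p : D.Point) (a : Label) (i j : ℤ) :
    D.Part p a i →ₗ[(ZMod 2)[X]] D.Part p a j :=
  D.proj p a j ∘ₗ D.diff i j ∘ₗ (D.Part p a i).subtype

theorem circle_of_touching {α β : Fin D.n → Bool} {j : Fin D.n}
    (hβ : β = Function.update α j true) {p : D.Point}
    (hp : D.circle α p = D.circle α (Sum.inl (j, 0)) ∨
      D.circle α p = D.circle α (Sum.inl (j, 2))) :
    D.circle β p = D.circle β (Sum.inl (j, 0)) ∨ D.circle β p = D.circle β (Sum.inl (j, 2)) := by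
  let T : D.Point → Prop := fun q =>
    D.circle β q = D.circle β (Sum.inl (j, 0)) ∨ D.circle β q = D.circle β (Sum.inl (j, 2))
  have hj : ∀ k, T (Sum.inl (j, k)) := by
    have hb : β j = true := by simp [hβ]
    have h0 : D.circle β (Sum.inl (j, 0)) = D.circle β (Sum.inl (j, resolve (β j) 0)) :=
      Quot.sound (Joined.crossing j 0)
    have h1 : D.circle β (Sum.inl (j, 1)) = D.circle β (Sum.inl (j, resolve (β j) 1)) :=
      Quot.sound (Joined.crossing j 1)
    rw [hb] at h0 h1
    intro k
    fin_cases k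
    · exact Or.inl rfl
    · exact Or.inr h1
    · exact Or.inr rfl
    · exact Or.inl h0.symm
  have key : ∀ q r, D.Joined α q r → T q = T r := by
    intro q r h
    cases h with
    | arc d =>
      have e : D.circle β (Sum.inl d) = D.circle β (Sum.inl (D.pair d)) :=
        Quot.sound (Joined.arc d)
      simp only [T, e]
    | crossing c k =>
      by_cases hc : c = j
      · subst hc
        exact propext ⟨fun _ => hj _, fun _ => hj _⟩
      · have e : D.circle β (Sum.inl (c, k)) =
            D.circle β (Sum.inl (c, resolve (α c) k)) := by
          have := Quot.sound (Joined.crossing (D := D) (α := β) c k)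
          rwa [hβ, Function.update_of_ne hc, ← hβ] at this
        simp only [T, e]
  have lift : ∀ q r, D.circle α q = D.circle α r → T q = T r :=
    fun q r h => congrArg (Quot.lift T key) h
  rcases hp with hp | hp
  · exact (lift _ _ hp).mpr (hj 0)
  · exact (lift _ _ hp).mpr (hj 2)

theorem edgeCoeff_eq_zero (p : D.Point) {μ δ : Label → Label → Label → ZMod 2}
    (hμ : ∀ a b, a = Label.x ∨ b = Label.x → μ a b Label.one = 0)
    (hδ : ∀ b c, b = Label.one ∨ c = Label.one → δ Label.x b c = 0) (j : Fin D.n) (s t : D.State)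
    (hs : s.2 (D.circle s.1 p) = Label.x) (ht : t.2 (D.circle t.1 p) = Label.one) :
    D.edgeCoeff μ δ j s t = 0 := by
  unfold edgeCoeff
  dsimp only
  split_ifs with h hm hsp
  · obtain ⟨-, hβ, hrest⟩ := h
    by_cases hp : D.circle s.1 p = D.circle s.1 (Sum.inl (j, 0)) ∨
        D.circle s.1 p = D.circle s.1 (Sum.inl (j, 2))
    · have ht' : t.2 (D.circle t.1 (Sum.inl (j, 0))) = Label.one := by
        rcases D.circle_of_touching hβ hp with h | h
        · rw [← h, ht]
        · rw [hm.2, ← h, ht]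
      rw [ht']
      apply hμ
      rcases hp with h | h
      · left; rw [← h, hs]
      · right; rw [← h, hs]
    · push Not at hp
      have := hrest p hp.1 hp.2
      rw [hs, ht] at this
      cases this
  · obtain ⟨-, hβ, hrest⟩ := h
    by_cases hp : D.circle s.1 p = D.circle s.1 (Sum.inl (j, 0)) ∨
        D.circle s.1 p = D.circle s.1 (Sum.inl (j, 2))
    · have hs' : s.2 (D.circle s.1 (Sum.inl (j, 0))) = Label.x := by
        rcases hp with h | h
        · rw [← h, hs]
        · rw [hsp.1, ← h, hs]
      rw [hs']
      apply hδ
      rcases D.circle_of_touching hβ hp with h | h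
      · left; rw [← h, ht]
      · right; rw [← h, ht]
    · push Not at hp
      have := hrest p hp.1 hp.2
      rw [hs, ht] at this
      cases this
  · rfl
  · rfl

/-- `d + H h` maps `C_x` into itself. -/
theorem diff_mem_part_x (p : D.Point) (i j : ℤ) (v : D.Chain i) (hv : v ∈ D.Part p Label.x i) :
    D.diff i j v ∈ D.Part p Label.x j := by
  intro t ht
  have ht1 : t.1.2 (D.circle t.1.1 p) = Label.one := by
    cases h : t.1.2 (D.circle t.1.1 p)
    · rfl
    · exact absurd h ht
  simp only [diff, Matrix.mulVecLin_apply, Matrix.mulVec, dotProduct, Matrix.of_apply]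
  refine Finset.sum_eq_zero fun s _ => ?_
  by_cases hs : s.1.2 (D.circle s.1.1 p) = Label.x
  · have h1 : D.dCoeff s.1 t.1 = 0 := Finset.sum_eq_zero fun k _ =>
      D.edgeCoeff_eq_zero p (by rintro (_ | _) (_ | _) h <;> simp_all [Label.mul])
        (by rintro (_ | _) (_ | _) h <;> simp_all [Label.comul]) k _ _ hs ht1
    have h2 : D.hCoeff s.1 t.1 = 0 := Finset.sum_eq_zero fun k _ =>
      D.edgeCoeff_eq_zero p (by rintro (_ | _) (_ | _) h <;> simp_all [Label.mul'])
        (by rintro (_ | _) (_ | _) h <;> simp_all [Label.comul']) k _ _ hs ht1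
    simp [h1, h2]
  · rw [hv s hs, mul_zero]

/-- The reduced Bar-Natan homology `H(C_a)` in degree `i`. -/
abbrev RedBN (p : D.Point) (a : Label) (i : ℤ) : Type :=
  MiddleHomology (D.redDiff p a (i - 1) i) (D.redDiff p a i (i + 1))

end LinkDiagram

/-! The inclusion of `C_x` has a chain retraction. With `H` built in, the edge maps are the
multiplication and comultiplication of `V = 𝔽₂[H][x]/(x² = Hx)`. They commute with multiplication by
`x` at the basepoint circle, and with the conjugation `σ : x ↦ x + H` applied to all circles at
once. Since `σ` is the identity modulo `H`, it is `1 + Hν`, and `ν` commutes with the differential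
because the chain groups are torsion-free. Hence `r = x_p · ν` is a chain map into `C_x`. It fixes
`C_x`: as `x(x + H) = 0`, one gets `H · r(x_p v) = x_p (x_p v + σ(x_p v)) = x_p² v = H x_p v`. So
`r` together with the projection to `C_1` splits the complex.

The identities are verified after evaluating the `x` of each circle at a root `0` or `H`, an
injective operation. There `σ` swaps the roots and `r` becomes the formula of
`labelEval_mul_retraction`; a merge pulls back roots, and a split does so up to a factor `H` or `0`.
The main steps are `retraction_apply_of_eq`, `retraction_mul_edgeBlock` and `splitting_diff`. -/

instance : Fintype Label := ⟨{Label.one, Label.x}, by rintro (_ | _) <;> simp⟩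

theorem Label.sum_univ {M : Type*} [AddCommMonoid M] (f : Label → M) :
    ∑ l, f l = f Label.one + f Label.x := by
  have : (Finset.univ : Finset Label) = {Label.one, Label.x} := rfl
  rw [this, Finset.sum_pair (by decide)]

/-! ### Tensor products of matrices. -/

/-- The tensor product of a family of matrices, as a matrix indexed by functions. -/
def tensorMatrix {Z m n R : Type*} [Fintype Z] [CommRing R] (f : Z → Matrix m n R) :
    Matrix (Z → m) (Z → n) R :=
  Matrix.of fun b a => ∏ c, f c (b c) (a c)

theorem tensorMatrix_apply {Z m n R : Type*} [Fintype Z] [CommRing R] (f : Z → Matrix m n R)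
    (b : Z → m) (a : Z → n) : tensorMatrix f b a = ∏ c, f c (b c) (a c) := rfl

theorem tensorMatrix_mul {Z l m n R : Type*} [Fintype Z] [DecidableEq Z] [Fintype m] [CommRing R]
    (f : Z → Matrix l m R) (g : Z → Matrix m n R) :
    tensorMatrix f * tensorMatrix g = tensorMatrix fun c => f c * g c := by
  ext b a
  simp only [Matrix.mul_apply, tensorMatrix_apply, Fintype.prod_sum, Finset.prod_mul_distrib]

theorem tensorMatrix_smul_one {Z n R : Type*} [Fintype Z] [DecidableEq Z] [DecidableEq n]
    [CommRing R] (r : R) :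
    tensorMatrix (fun _ : Z => r • (1 : Matrix n n R)) = r ^ Fintype.card Z • 1 := by
  ext b a
  rw [tensorMatrix_apply]
  by_cases h : b = a
  · subst h; simp
  · obtain ⟨c, hc⟩ := Function.ne_iff.mp h
    rw [Finset.prod_eq_zero (Finset.mem_univ c) (by simp [hc])]
    simp [h]

/-! ### Evaluation at the roots, for a single circle. -/

/-- The evaluations of `1` and `x` at the two roots `0` and `H` of `x ^ 2 = H x`. -/
noncomputable def evalMatrix : Matrix Bool Label (ZMod 2)[X]
  | _, .one => 1
  | false, .x => 0
  | true, .x => X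

/-- The adjugate of `evalMatrix`. -/
noncomputable def evalAdjugate : Matrix Label Bool (ZMod 2)[X]
  | .one, false => X
  | .one, true => 0
  | .x, _ => 1

/-- The conjugation `1 ↦ 1`, `x ↦ x + H`. -/
noncomputable def conjMatrix : Matrix Label Label (ZMod 2)[X]
  | .one, .one => 1
  | .one, .x => X
  | .x, .one => 0
  | .x, .x => 1

/-- Multiplication by `x`. -/
noncomputable def mulXMatrix : Matrix Label Label (ZMod 2)[X]
  | .one, _ => 0
  | .x, .one => 1
  | .x, .x => X

/-- The determinant of the evaluation is the difference `H` of the roots, so evaluation is injective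
without being invertible. -/
theorem evalAdjugate_mul : evalAdjugate * evalMatrix = (X : (ZMod 2)[X]) • 1 := by
  ext1 a b
  cases a <;> cases b <;>
    simp [Matrix.mul_apply, evalAdjugate, evalMatrix, CharTwo.two_eq_zero]

/-- In characteristic 2, `x + H` takes the value `H` at `0` and `0` at `H`: conjugation swaps the
roots. -/
theorem evalMatrix_mul_conj (e : Bool) (l : Label) :
    (evalMatrix * conjMatrix) e l = evalMatrix (!e) l := by
  cases e <;> cases l <;>
    simp [Matrix.mul_apply, Label.sum_univ, conjMatrix, evalMatrix, CharTwo.add_self_eq_zero]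

theorem evalMatrix_mul_mulX (e : Bool) (l : Label) :
    (evalMatrix * mulXMatrix) e l = (if e then X else 0) * evalMatrix e l := by
  cases e <;> cases l <;>
    simp [Matrix.mul_apply, Label.sum_univ, mulXMatrix, evalMatrix]

/-! ### The retraction at a single vertex of the cube. -/

section Labellings

variable {Z : Type*} [Fintype Z] [DecidableEq Z]

/-- Evaluation of labellings at all choices of roots for the circles. -/
noncomputable def labelEval (Z : Type*) [Fintype Z] : Matrix (Z → Bool) (Z → Label) (ZMod 2)[X] :=
  tensorMatrix fun _ => evalMatrix

theorem labelEval_cancel {n : Type*} {M N : Matrix (Z → Label) n (ZMod 2)[X]}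
    (h : labelEval Z * M = labelEval Z * N) : M = N := by
  have h' := congrArg (fun K => (tensorMatrix fun _ : Z => evalAdjugate) * K) h
  simp only [← Matrix.mul_assoc, labelEval, tensorMatrix_mul, evalAdjugate_mul,
    tensorMatrix_smul_one, Matrix.smul_mul, Matrix.one_mul] at h'
  ext1 a b
  have h2 := congrFun (congrFun h' a) b
  simp only [Matrix.smul_apply, smul_eq_mul] at h2
  exact mul_left_cancel₀ (pow_ne_zero _ X_ne_zero) h2

/-- At `H = 0` conjugation is the identity, so every entry of the difference is divisible by `H`;
the sign is immaterial in characteristic 2. -/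
theorem exists_conj_sub_one (Z : Type*) [Fintype Z] [DecidableEq Z] :
    ∃ N : Matrix (Z → Label) (Z → Label) (ZMod 2)[X],
      (tensorMatrix fun _ : Z => conjMatrix) + 1 = (X : (ZMod 2)[X]) • N := by
  have key : ∀ b a : Z → Label,
      (X : (ZMod 2)[X]) ∣ ((tensorMatrix fun _ : Z => conjMatrix) + 1) b a := by
    intro b a
    have hc : ∀ k l, (conjMatrix k l).eval 0 = (1 : Matrix Label Label (ZMod 2)) k l := by
      rintro (_ | _) (_ | _) <;> simp [conjMatrix]
    have h1 : ((tensorMatrix fun _ : Z => conjMatrix) b a).eval 0 =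
        (1 : Matrix (Z → Label) (Z → Label) (ZMod 2)) b a := by
      have := tensorMatrix_smul_one (Z := Z) (n := Label) (1 : ZMod 2)
      simp only [one_smul, one_pow] at this
      rw [← this, tensorMatrix_apply, tensorMatrix_apply, eval_prod]
      exact Finset.prod_congr rfl fun c _ => hc _ _
    rw [X_dvd_iff, coeff_zero_eq_eval_zero, Matrix.add_apply, eval_add, h1]
    by_cases h : b = a
    · subst h; simp [CharTwo.add_self_eq_zero]
    · simp [h]
  choose N hN using key
  exact ⟨Matrix.of N, by ext1 b a; simpa using hN b a⟩

/-- The operator `x · ν`, where multiplication by `x` takes place at the circle `q` and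
`1 + H ν` is the conjugation of all circles. -/
noncomputable def retraction (q : Z) : Matrix (Z → Label) (Z → Label) (ZMod 2)[X] :=
  (tensorMatrix fun c => if c = q then mulXMatrix else 1) * (exists_conj_sub_one Z).choose

/-- After evaluation, multiplication by `x` at `q` is the scalar `0` or `H`, and `ν` is the sum of
the values at `e` and at the opposite roots, divided by `H`. The two factors `H` cancel. -/
theorem labelEval_mul_retraction (q : Z) (e : Z → Bool) (a : Z → Label) :
    (labelEval Z * retraction q) e a =
      (if e q then 1 else 0) * (labelEval Z e a + labelEval Z (fun c => !e c) a) := by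
  have hN := (exists_conj_sub_one Z).choose_spec
  let δ : Matrix (Z → Bool) (Z → Bool) (ZMod 2)[X] :=
    Matrix.diagonal fun e => if e q then X else 0
  have hδ : ∀ (M : Matrix (Z → Bool) (Z → Label) (ZMod 2)[X]) e a,
      (δ * M) e a = (if e q then X else 0) * M e a := fun M e a => Matrix.diagonal_mul _ _ _ _
  have h1 : labelEval Z * (tensorMatrix fun c => if c = q then mulXMatrix else 1) =
      δ * labelEval Z := by
    ext1 e a
    rw [hδ, labelEval, tensorMatrix_mul, tensorMatrix_apply, tensorMatrix_apply,
      ← Finset.mul_prod_erase _ _ (Finset.mem_univ q),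
      ← Finset.mul_prod_erase _ (fun c => evalMatrix (e c) (a c)) (Finset.mem_univ q), if_pos rfl,
      evalMatrix_mul_mulX, mul_assoc]
    congr 2
    refine Finset.prod_congr rfl fun c hc => ?_
    rw [if_neg (Finset.ne_of_mem_erase hc), Matrix.mul_one]
  have h2 : ∀ e a, (labelEval Z * tensorMatrix fun _ : Z => conjMatrix) e a =
      labelEval Z (fun c => !e c) a := by
    intro e a
    rw [labelEval, tensorMatrix_mul, tensorMatrix_apply, tensorMatrix_apply]
    simp only [evalMatrix_mul_conj]
  -- Only `Hν` is explicit, so the formula is proved after multiplication by `H`, which is then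
  -- cancelled.
  have h3 : (X : (ZMod 2)[X]) • (labelEval Z * retraction q) =
      δ *
        (labelEval Z * ((tensorMatrix fun _ : Z => conjMatrix) + 1)) := by
    rw [hN, retraction, ← Matrix.mul_assoc, h1, Matrix.mul_smul, Matrix.mul_smul, Matrix.mul_assoc]
  have h4 := congrFun (congrFun h3 e) a
  rw [hδ, Matrix.mul_add, Matrix.add_apply, h2, Matrix.mul_one,
    Matrix.smul_apply, smul_eq_mul] at h4
  apply mul_left_cancel₀ (X_ne_zero (R := ZMod 2))
  rw [h4]
  split_ifs <;> ring

theorem retraction_apply_of_ne (q : Z) {b : Z → Label} (hb : b q ≠ Label.x) (a : Z → Label) :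
    retraction q b a = 0 := by
  rw [retraction, Matrix.mul_apply]
  refine Finset.sum_eq_zero fun u _ => ?_
  rw [tensorMatrix_apply, Finset.prod_eq_zero (Finset.mem_univ q), zero_mul]
  rw [if_pos rfl]
  cases h : b q
  · rfl
  · exact absurd h hb

/-- A labelling with `x` at `q` evaluates to zero wherever `q` has root `0`. Of the values at `e`
and at its opposite, only the one with root `H` at `q` can survive. -/
theorem retraction_apply_of_eq (q : Z) {a : Z → Label} (ha : a q = Label.x) (b : Z → Label) :
    retraction q b a = (1 : Matrix (Z → Label) (Z → Label) (ZMod 2)[X]) b a := by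
  have h0 : ∀ e : Z → Bool, e q = false → labelEval Z e a = 0 := fun e he => by
    rw [labelEval, tensorMatrix_apply, Finset.prod_eq_zero (Finset.mem_univ q)]
    rw [he, ha]; rfl
  have h : labelEval Z * (Matrix.of fun b (_ : Unit) => retraction q b a) =
      labelEval Z * (Matrix.of fun b (_ : Unit) =>
        (1 : Matrix (Z → Label) (Z → Label) (ZMod 2)[X]) b a) := by
    ext1 e _
    have h1 : (labelEval Z * (Matrix.of fun b (_ : Unit) => retraction q b a)) e () =
        (labelEval Z * retraction q) e a := rfl
    have h2 : (labelEval Z * (Matrix.of fun b (_ : Unit) =>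
        (1 : Matrix (Z → Label) (Z → Label) (ZMod 2)[X]) b a)) e () =
        (labelEval Z * (1 : Matrix (Z → Label) (Z → Label) (ZMod 2)[X])) e a := rfl
    rw [h1, h2, Matrix.mul_one, labelEval_mul_retraction]
    cases he : e q
    · simp [h0 e he]
    · rw [h0 (fun c => !e c) (by simp [he])]; simp
  exact congrFun (congrFun (labelEval_cancel h) b) ()

/-- A map that is, after evaluation, a multiple of pulling back roots commutes with `retraction`. -/
theorem retraction_mul_comm {A B : Type*} [Fintype A] [DecidableEq A] [Fintype B] [DecidableEq B]
    (qA : A) (qB : B) (E : Matrix (B → Label) (A → Label) (ZMod 2)[X])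
    (hE : ∀ e : B → Bool, ∃ (e' : A → Bool) (τ : (ZMod 2)[X]), e' qA = e qB ∧
      ∀ a, (labelEval B * E) e a = τ * labelEval A e' a ∧
        (labelEval B * E) (fun c => !e c) a = τ * labelEval A (fun c => !e' c) a) :
    retraction qB * E = E * retraction qA := by
  apply labelEval_cancel
  ext1 e a
  -- The same factor `τ` serves `e` and its opposite, so it comes out of the sum of the two values.
  obtain ⟨e', τ, hq, h⟩ := hE e
  have h1 : (labelEval B * (E * retraction qA)) e a = τ * (labelEval A * retraction qA) e' a := by
    rw [← Matrix.mul_assoc, Matrix.mul_apply, Matrix.mul_apply, Finset.mul_sum]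
    exact Finset.sum_congr rfl fun u _ => by rw [(h u).1, mul_assoc]
  have h2 : (labelEval B * (retraction qB * E)) e a = (if e qB then 1 else 0) *
      ((labelEval B * E) e a + (labelEval B * E) (fun c => !e c) a) := by
    rw [← Matrix.mul_assoc]
    simp only [Matrix.mul_apply (N := E), labelEval_mul_retraction]
    rw [← Finset.sum_add_distrib, Finset.mul_sum]
    exact Finset.sum_congr rfl fun u _ => by ring
  rw [h1, h2, labelEval_mul_retraction, (h a).1, (h a).2, hq]
  ring

end Labellings

/-! ### Merge and split maps after evaluation. -/

/-- The entries of `m + H m'`. -/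
noncomputable def bnMul (a b c : Label) : (ZMod 2)[X] :=
  C (Label.mul a b c) + X * C (Label.mul' a b c)

/-- The entries of `Δ + H Δ'`. -/
noncomputable def bnComul (a b c : Label) : (ZMod 2)[X] :=
  C (Label.comul a b c) + X * C (Label.comul' a b c)

theorem sum_bnMul (e : Bool) (a b : Label) :
    ∑ l, bnMul a b l * evalMatrix e l = evalMatrix e a * evalMatrix e b := by
  rw [Label.sum_univ]
  cases e <;> cases a <;> cases b <;> simp [bnMul, Label.mul, Label.mul', evalMatrix]

/-- The coproduct of `1` is `x ⊗ 1 + 1 ⊗ x + H`, which vanishes at two different roots and equals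
`H` at two equal ones; the coproduct of `x` is `x` times this. -/
theorem sum_bnComul (e f : Bool) (a : Label) :
    ∑ l : Label × Label, bnComul a l.1 l.2 * (evalMatrix e l.1 * evalMatrix f l.2) =
      if e = f then X * evalMatrix e a else 0 := by
  rw [Fintype.sum_prod_type]
  simp only [Label.sum_univ]
  cases e <;> cases f <;> cases a <;>
    simp [bnComul, Label.comul, Label.comul', evalMatrix, CharTwo.add_self_eq_zero]

section

variable {A B : Type*} [Fintype A] [DecidableEq A] [Fintype B] [DecidableEq B]

open Classical in
-- Only the label of the merged circle is free, so the sum reduces to `sum_bnMul`; the other circles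
-- correspond bijectively under `π`.
theorem sum_merge (π : A → B) (hπ : Function.Surjective π) (c₁ c₂ : A) (hne : c₁ ≠ c₂)
    (heq : π c₁ = π c₂)
    (hinj : ∀ c d, π c = π d → c = d ∨ ((c = c₁ ∨ c = c₂) ∧ (d = c₁ ∨ d = c₂)))
    (e : B → Bool) (a : A → Label) :
    ∑ b : B → Label, labelEval B e b *
        (if ∀ c, c ≠ c₁ → c ≠ c₂ → b (π c) = a c then bnMul (a c₁) (a c₂) (b (π c₁)) else 0) =
      labelEval A (fun c => e (π c)) a := by
  obtain ⟨s, hs⟩ := hπ.hasRightInverse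
  have hsπ : ∀ c, c ≠ c₁ → c ≠ c₂ → s (π c) = c := fun c h1 h2 => by
    rcases hinj _ _ (hs (π c)) with h | h
    · exact h
    · tauto
  have hne0 : ∀ c, c ≠ c₁ → c ≠ c₂ → π c ≠ π c₁ := fun c h1 h2 h => by
    rcases hinj _ _ h with h | h <;> tauto
  rw [← Fintype.sum_of_injective
    (fun l : Label => Function.update (fun d => a (s d)) (π c₁) l)
    (fun l k h => by simpa using congrFun h (π c₁))
    (fun l => bnMul (a c₁) (a c₂) l * evalMatrix (e (π c₁)) l *
      ∏ d ∈ Finset.univ.erase (π c₁), evalMatrix (e d) (a (s d)))]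
  · rw [← Finset.sum_mul, sum_bnMul, labelEval, tensorMatrix_apply,
      ← Finset.mul_prod_erase _ _ (Finset.mem_univ c₁),
      ← Finset.mul_prod_erase (Finset.univ.erase c₁) _
        (Finset.mem_erase.mpr ⟨hne.symm, Finset.mem_univ c₂⟩), ← mul_assoc, heq]
    congr 1
    symm
    refine Finset.prod_bij (fun c _ => π c) ?_ ?_ ?_ ?_
    · intro c hc
      simp only [Finset.mem_erase, Finset.mem_univ, and_true] at hc ⊢
      rw [← heq]
      exact hne0 c hc.2 hc.1
    · intro c hc d hd h
      simp only [Finset.mem_erase, Finset.mem_univ, and_true] at hc hd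
      rcases hinj _ _ h with h | h <;> tauto
    · intro d hd
      simp only [Finset.mem_erase, Finset.mem_univ, and_true] at hd
      refine ⟨s d, ?_, hs d⟩
      simp only [Finset.mem_erase, Finset.mem_univ, and_true]
      exact ⟨fun h => hd (by rw [← hs d, h]), fun h => hd (by rw [← hs d, h, heq])⟩
    · intro c hc
      simp only [Finset.mem_erase, Finset.mem_univ, and_true] at hc
      rw [hsπ c hc.2 hc.1]
  · intro b hb
    rw [if_neg, mul_zero]
    intro h
    refine hb ⟨b (π c₁), ?_⟩
    funext d
    by_cases hd : d = π c₁
    · subst hd; simp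
    · simp only [Function.update_of_ne hd]
      rw [← h (s d) (fun h => hd (by rw [← hs d, h])) (fun h => hd (by rw [← hs d, h, heq])), hs]
  · intro l
    rw [if_pos, labelEval, tensorMatrix_apply, ← Finset.mul_prod_erase _ _ (Finset.mem_univ (π c₁)),
      Function.update_self]
    · have h : ∏ d ∈ Finset.univ.erase (π c₁), evalMatrix (e d)
          (Function.update (fun d => a (s d)) (π c₁) l d) =
          ∏ d ∈ Finset.univ.erase (π c₁), evalMatrix (e d) (a (s d)) :=
        Finset.prod_congr rfl fun d hd => by
          rw [Function.update_of_ne (Finset.ne_of_mem_erase hd)]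
      rw [h]
      ring
    · intro c h1 h2
      rw [Function.update_of_ne (hne0 c h1 h2), hsπ c h1 h2]

open Classical in
-- The section picks one of `c₁`, `c₂` over the split circle. The choice is harmless, since the
-- factor in front vanishes unless both carry the same root.
theorem sum_split (π : B → A) (hπ : Function.Surjective π) (c₁ c₂ : B) (hne : c₁ ≠ c₂)
    (heq : π c₁ = π c₂)
    (hinj : ∀ c d, π c = π d → c = d ∨ ((c = c₁ ∨ c = c₂) ∧ (d = c₁ ∨ d = c₂)))
    (e : B → Bool) (a : A → Label) :
    ∑ b : B → Label, labelEval B e b *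
        (if ∀ c, c ≠ c₁ → c ≠ c₂ → b c = a (π c) then bnComul (a (π c₁)) (b c₁) (b c₂) else 0) =
      (if e c₁ = e c₂ then X else 0) *
        labelEval A (fun d => e (Function.surjInv hπ d)) a := by
  set s := Function.surjInv hπ
  have hs : ∀ d, π (s d) = d := Function.surjInv_eq hπ
  have hsπ : ∀ c, c ≠ c₁ → c ≠ c₂ → s (π c) = c := fun c h1 h2 => by
    rcases hinj _ _ (hs (π c)) with h | h
    · exact h
    · tauto
  have hs1 : s (π c₁) = c₁ ∨ s (π c₁) = c₂ := by
    rcases hinj _ _ (hs (π c₁)) with h | h <;> tauto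
  have hne0 : ∀ c, c ≠ c₁ → c ≠ c₂ → π c ≠ π c₁ := fun c h1 h2 h => by
    rcases hinj _ _ h with h | h <;> tauto
  rw [← Fintype.sum_of_injective
    (fun l : Label × Label => Function.update (Function.update (fun d => a (π d)) c₁ l.1) c₂ l.2)
    (fun l k h => by
      have h1 := congrFun h c₁
      have h2 := congrFun h c₂
      simp only [Function.update_of_ne hne, Function.update_self] at h1 h2
      exact Prod.ext h1 h2)
    (fun l => bnComul (a (π c₁)) l.1 l.2 * (evalMatrix (e c₁) l.1 * evalMatrix (e c₂) l.2) *
      ∏ d ∈ (Finset.univ.erase c₁).erase c₂, evalMatrix (e d) (a (π d)))]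
  · rw [← Finset.sum_mul, sum_bnComul]
    split_ifs with he
    · rw [labelEval, tensorMatrix_apply, ← Finset.mul_prod_erase _ _ (Finset.mem_univ (π c₁)),
        mul_assoc]
      have : e (s (π c₁)) = e c₁ := by rcases hs1 with h | h <;> rw [h]; exact he.symm
      rw [this]
      congr 2
      refine Finset.prod_bij (fun c _ => π c) ?_ ?_ ?_ ?_
      · intro c hc
        simp only [Finset.mem_erase, Finset.mem_univ, and_true] at hc ⊢
        exact hne0 c hc.2 hc.1
      · intro c hc d hd h
        simp only [Finset.mem_erase, Finset.mem_univ, and_true] at hc hd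
        rcases hinj _ _ h with h | h <;> tauto
      · intro d hd
        simp only [Finset.mem_erase, Finset.mem_univ, and_true] at hd
        refine ⟨s d, ?_, hs d⟩
        simp only [Finset.mem_erase, Finset.mem_univ, and_true]
        exact ⟨fun h => hd (by rw [← hs d, h, heq]), fun h => hd (by rw [← hs d, h])⟩
      · intro c hc
        simp only [Finset.mem_erase, Finset.mem_univ, and_true] at hc
        rw [hsπ c hc.2 hc.1]
    · rw [zero_mul, zero_mul]
  · intro b hb
    rw [if_neg, mul_zero]
    intro h
    refine hb ⟨(b c₁, b c₂), ?_⟩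
    funext d
    by_cases hd2 : d = c₂
    · subst hd2; simp
    by_cases hd1 : d = c₁
    · subst hd1; simp [Function.update_of_ne hd2]
    · simp only [Function.update_of_ne hd1, Function.update_of_ne hd2]
      rw [h d hd1 hd2]
  · intro l
    rw [if_pos, labelEval, tensorMatrix_apply, ← Finset.mul_prod_erase _ _ (Finset.mem_univ c₁),
      ← Finset.mul_prod_erase (Finset.univ.erase c₁) _
        (Finset.mem_erase.mpr ⟨hne.symm, Finset.mem_univ c₂⟩),
      Function.update_self, Function.update_of_ne hne, Function.update_self]
    · have h : ∏ d ∈ (Finset.univ.erase c₁).erase c₂, evalMatrix (e d)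
          (Function.update (Function.update (fun d => a (π d)) c₁ l.1) c₂ l.2 d) =
          ∏ d ∈ (Finset.univ.erase c₁).erase c₂, evalMatrix (e d) (a (π d)) :=
        Finset.prod_congr rfl fun d hd => by
          rw [Function.update_of_ne (Finset.ne_of_mem_erase hd),
            Function.update_of_ne (Finset.ne_of_mem_erase (Finset.mem_of_mem_erase hd))]
      rw [h]
      ring
    · intro c h1 h2
      rw [Function.update_of_ne h2, Function.update_of_ne h1]

end

/-! ### Homology of a direct sum. -/

/-- Homology is compatible with binary products, up to isomorphism of the complexes. -/
theorem nonempty_middleHomology_prod {R A B C A₁ B₁ C₁ A₂ B₂ C₂ : Type*} [CommRing R]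
    [AddCommGroup A] [AddCommGroup B] [AddCommGroup C] [Module R A] [Module R B] [Module R C]
    [AddCommGroup A₁] [AddCommGroup B₁] [AddCommGroup C₁] [Module R A₁] [Module R B₁] [Module R C₁]
    [AddCommGroup A₂] [AddCommGroup B₂] [AddCommGroup C₂] [Module R A₂] [Module R B₂] [Module R C₂]
    {f : A →ₗ[R] B} {g : B →ₗ[R] C} {f₁ : A₁ →ₗ[R] B₁} {g₁ : B₁ →ₗ[R] C₁}
    {f₂ : A₂ →ₗ[R] B₂} {g₂ : B₂ →ₗ[R] C₂}
    (eA : A ≃ₗ[R] A₁ × A₂) (eB : B ≃ₗ[R] B₁ × B₂) (eC : C ≃ₗ[R] C₁ × C₂)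
    (hf : ∀ a, eB (f a) = (f₁ (eA a).1, f₂ (eA a).2))
    (hg : ∀ b, eC (g b) = (g₁ (eB b).1, g₂ (eB b).2)) :
    Nonempty (MiddleHomology f g ≃ₗ[R] MiddleHomology f₁ g₁ × MiddleHomology f₂ g₂) := by
  have hk : ∀ b, g b = 0 ↔ g₁ (eB b).1 = 0 ∧ g₂ (eB b).2 = 0 := fun b => by
    rw [← eC.map_eq_zero_iff, hg, Prod.mk_eq_zero]
  let p₁ : LinearMap.ker g →ₗ[R] LinearMap.ker g₁ :=
    (LinearMap.fst R B₁ B₂ ∘ₗ eB.toLinearMap).restrict fun b hb => ((hk b).mp hb).1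
  let p₂ : LinearMap.ker g →ₗ[R] LinearMap.ker g₂ :=
    (LinearMap.snd R B₁ B₂ ∘ₗ eB.toLinearMap).restrict fun b hb => ((hk b).mp hb).2
  let φ : LinearMap.ker g →ₗ[R] MiddleHomology f₁ g₁ × MiddleHomology f₂ g₂ :=
    (Submodule.mkQ _ ∘ₗ p₁).prod (Submodule.mkQ _ ∘ₗ p₂)
  have hφ : Function.Surjective φ := by
    rintro ⟨y₁, y₂⟩
    obtain ⟨b₁, rfl⟩ := Submodule.mkQ_surjective _ y₁
    obtain ⟨b₂, rfl⟩ := Submodule.mkQ_surjective _ y₂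
    have hb : eB (eB.symm (b₁.1, b₂.1)) = (b₁.1, b₂.1) := eB.apply_symm_apply _
    refine ⟨⟨eB.symm (b₁.1, b₂.1), (hk _).mpr ?_⟩, ?_⟩
    · rw [hb]
      exact ⟨b₁.2, b₂.2⟩
    · refine Prod.ext ?_ ?_
      · exact congrArg (Submodule.mkQ _) (Subtype.ext (congrArg Prod.fst hb))
      · exact congrArg (Submodule.mkQ _) (Subtype.ext (congrArg Prod.snd hb))
  have hker : (LinearMap.range f).comap (LinearMap.ker g).subtype = LinearMap.ker φ := by
    ext b
    have h1 : φ b = 0 ↔ (∃ a₁, f₁ a₁ = (eB b.1).1) ∧ (∃ a₂, f₂ a₂ = (eB b.1).2) := by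
      rw [Prod.ext_iff]
      refine and_congr ?_ ?_
      · exact (Submodule.Quotient.mk_eq_zero _).trans Iff.rfl
      · exact (Submodule.Quotient.mk_eq_zero _).trans Iff.rfl
    rw [LinearMap.mem_ker, h1]
    constructor
    · rintro ⟨a, ha⟩
      have ha' : f a = b.1 := ha
      rw [← ha', hf]
      exact ⟨⟨_, rfl⟩, ⟨_, rfl⟩⟩
    · rintro ⟨⟨a₁, h₁⟩, ⟨a₂, h₂⟩⟩
      -- Preimages chosen independently in the two summands assemble to one preimage in `A`.
      refine ⟨eA.symm (a₁, a₂), eB.injective ?_⟩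
      rw [hf, eA.apply_symm_apply, h₁, h₂]
      rfl
  exact ⟨(Submodule.quotEquivOfEq _ _ hker).trans (φ.quotKerEquivOfSurjective hφ)⟩

/-! ### How circles change when one crossing is resolved differently. -/

namespace LinkDiagram

variable (D : LinkDiagram)

noncomputable instance (α : Fin D.n → Bool) : Fintype (D.Circle α) := Fintype.ofFinite _

noncomputable instance (α : Fin D.n → Bool) : DecidableEq (D.Circle α) := Classical.decEq _

/-- The circle through `q` touches the crossing `j`. -/
def Touches (α : Fin D.n → Bool) (j : Fin D.n) (q : D.Point) : Prop :=
  D.circle α q = D.circle α (Sum.inl (j, 0)) ∨ D.circle α q = D.circle α (Sum.inl (j, 2))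

variable {D} {α β : Fin D.n → Bool} {j : Fin D.n}

theorem circle_surjective (α : Fin D.n → Bool) : Function.Surjective (D.circle α) :=
  Quot.exists_rep

/-- Either resolution joins each of the half-edges `1`, `3` to one of `0`, `2`. -/
theorem touches_halfEdge (α : Fin D.n → Bool) (j : Fin D.n) (k : Fin 4) :
    D.Touches α j (Sum.inl (j, k)) := by
  have h : ∀ k, D.circle α (Sum.inl (j, k)) = D.circle α (Sum.inl (j, resolve (α j) k)) :=
    fun k => Quot.sound (Joined.crossing j k)
  have h1 := h 1
  have h3 := h 3
  unfold Touches
  cases hα : α j <;> rw [hα] at h1 h3 <;> fin_cases k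
  · exact Or.inl rfl
  · exact Or.inl h1
  · exact Or.inr rfl
  · exact Or.inr h3
  · exact Or.inl rfl
  · exact Or.inr h1
  · exact Or.inr rfl
  · exact Or.inl h3

theorem joined_or_eq_of_agree (h : ∀ c, c ≠ j → α c = β c) {q r : D.Point}
    (hqr : D.Joined α q r) :
    D.circle β q = D.circle β r ∨ ∃ k l, q = Sum.inl (j, k) ∧ r = Sum.inl (j, l) := by
  cases hqr with
  | arc d => exact Or.inl (Quot.sound (Joined.arc d))
  | crossing c k =>
    by_cases hc : c = j
    · subst hc
      exact Or.inr ⟨_, _, rfl, rfl⟩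
    · rw [h c hc]
      exact Or.inl (Quot.sound (Joined.crossing c k))

theorem Touches.of_agree (h : ∀ c, c ≠ j → α c = β c) {q : D.Point} (hq : D.Touches α j q) :
    D.Touches β j q := by
  have key : ∀ q r, D.Joined α q r → D.Touches β j q = D.Touches β j r := by
    intro q r hqr
    rcases joined_or_eq_of_agree h hqr with e | ⟨k, l, rfl, rfl⟩
    · simp only [Touches, e]
    · exact propext ⟨fun _ => touches_halfEdge _ _ _, fun _ => touches_halfEdge _ _ _⟩
  have lift : ∀ q r, D.circle α q = D.circle α r → D.Touches β j q = D.Touches β j r :=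
    fun q r e => congrArg (Quot.lift (D.Touches β j) key) e
  rcases hq with e | e
  · exact (lift _ _ e).mpr (touches_halfEdge _ _ _)
  · exact (lift _ _ e).mpr (touches_halfEdge _ _ _)

/-- Along a chain of adjacencies from `q` to `r`, every step away from `j` persists in `β`; once a
step at `j` occurs, both ends lie on circles touching `j`. -/
theorem circle_eq_of_agree (h : ∀ c, c ≠ j → α c = β c) {q r : D.Point}
    (hqr : D.circle α q = D.circle α r) :
    D.circle β q = D.circle β r ∨ (D.Touches β j q ∧ D.Touches β j r) := by
  have hgen : Relation.EqvGen (D.Joined α) q r := Quot.eqvGen_exact hqr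
  induction hgen with
  | rel q r hj =>
    rcases joined_or_eq_of_agree h hj with e | ⟨k, l, rfl, rfl⟩
    · exact Or.inl e
    · exact Or.inr ⟨touches_halfEdge _ _ _, touches_halfEdge _ _ _⟩
  | refl q => exact Or.inl rfl
  | symm q r hg ih =>
    rcases ih (Quot.eqvGen_sound hg) with e | e
    · exact Or.inl e.symm
    · exact Or.inr e.symm
  | trans q r s h1 h2 ih1 ih2 =>
    rcases ih1 (Quot.eqvGen_sound h1) with e | e <;> rcases ih2 (Quot.eqvGen_sound h2) with f | f
    · exact Or.inl (e.trans f)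
    · refine Or.inr ⟨?_, f.2⟩
      simpa only [Touches, e] using f.1
    · refine Or.inr ⟨e.1, ?_⟩
      simpa only [Touches, f] using e.2
    · exact Or.inr ⟨e.1, f.2⟩

/-- If the touching circles of `β` coincide, then the circles of `α` map to those of `β`. -/
theorem exists_circle_map (h : ∀ c, c ≠ j → α c = β c)
    (hβ : D.circle β (Sum.inl (j, 0)) = D.circle β (Sum.inl (j, 2))) :
    ∃ π : D.Circle α → D.Circle β, Function.Surjective π ∧
      (∀ q, π (D.circle α q) = D.circle β q) ∧
      ∀ c d, π c = π d → c = d ∨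
        ((c = D.circle α (Sum.inl (j, 0)) ∨ c = D.circle α (Sum.inl (j, 2))) ∧
          (d = D.circle α (Sum.inl (j, 0)) ∨ d = D.circle α (Sum.inl (j, 2)))) := by
  have hw : ∀ q r, D.circle α q = D.circle α r → D.circle β q = D.circle β r := by
    intro q r e
    rcases circle_eq_of_agree h e with e | ⟨e | e, f | f⟩
    · exact e
    · exact e.trans f.symm
    · exact e.trans (hβ.trans f.symm)
    · exact e.trans (hβ.symm.trans f.symm)
    · exact e.trans f.symm
  let π : D.Circle α → D.Circle β := Quot.lift (D.circle β) fun q r e => hw q r (Quot.sound e)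
  have hπ : ∀ q, π (D.circle α q) = D.circle β q := fun _ => rfl
  refine ⟨π, fun d => ?_, hπ, fun c d e => ?_⟩
  · obtain ⟨q, rfl⟩ := circle_surjective β d
    exact ⟨D.circle α q, hπ q⟩
  · obtain ⟨q, rfl⟩ := circle_surjective α c
    obtain ⟨r, rfl⟩ := circle_surjective α d
    exact circle_eq_of_agree (fun c hc => (h c hc).symm) e

/-! ### The retraction commutes with the differential. -/

variable (D)

/-- The edge map of `d + H h` at the crossing `j`. -/
noncomputable def edgeMatrix (j : Fin D.n) : Matrix D.State D.State (ZMod 2)[X] :=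
  Matrix.of fun t s => C (D.edgeCoeff Label.mul Label.comul j s t) +
    X * C (D.edgeCoeff Label.mul' Label.comul' j s t)

/-- The block of `edgeMatrix` between two vertices of the hypercube. -/
noncomputable def edgeBlock (j : Fin D.n) (α β : Fin D.n → Bool) :
    Matrix (D.Circle β → Label) (D.Circle α → Label) (ZMod 2)[X] :=
  Matrix.of fun b a => D.edgeMatrix j ⟨β, b⟩ ⟨α, a⟩

theorem retraction_mul_edgeBlock (p : D.Point) (j : Fin D.n) (α β : Fin D.n → Bool) :
    retraction (D.circle β p) * D.edgeBlock j α β =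
      D.edgeBlock j α β * retraction (D.circle α p) := by
  classical
  have hzero : D.edgeBlock j α β = 0 → retraction (D.circle β p) * D.edgeBlock j α β =
      D.edgeBlock j α β * retraction (D.circle α p) := fun h => by
    rw [h, Matrix.mul_zero, Matrix.zero_mul]
  -- Off the edges of the cube in direction `j` the block vanishes.
  by_cases hv : α j = false ∧ β = Function.update α j true
  swap
  · apply hzero
    ext1 b a
    simp only [edgeBlock, edgeMatrix, edgeCoeff, Matrix.of_apply, Matrix.zero_apply]
    rw [if_neg fun h => hv ⟨h.1, h.2.1⟩, if_neg fun h => hv ⟨h.1, h.2.1⟩]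
    simp
  have hag : ∀ c, c ≠ j → α c = β c := fun c hc => by
    rw [hv.2, Function.update_of_ne hc]
  have hag' : ∀ c, c ≠ j → β c = α c := fun c hc => (hag c hc).symm
  by_cases hm : D.circle α (Sum.inl (j, 0)) ≠ D.circle α (Sum.inl (j, 2)) ∧
      D.circle β (Sum.inl (j, 0)) = D.circle β (Sum.inl (j, 2))
  · obtain ⟨π, hsurj, hπ, hinj⟩ := exists_circle_map hag hm.2
    have hE : ∀ b a, D.edgeBlock j α β b a =
        if ∀ c, c ≠ D.circle α (Sum.inl (j, 0)) → c ≠ D.circle α (Sum.inl (j, 2)) →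
          b (π c) = a c then
        bnMul (a (D.circle α (Sum.inl (j, 0)))) (a (D.circle α (Sum.inl (j, 2))))
          (b (π (D.circle α (Sum.inl (j, 0))))) else 0 := by
      intro b a
      have hiff : (α j = false ∧ β = Function.update α j true ∧
          ∀ p : D.Point, D.circle α p ≠ D.circle α (Sum.inl (j, 0)) →
            D.circle α p ≠ D.circle α (Sum.inl (j, 2)) →
            b (D.circle β p) = a (D.circle α p)) ↔
          ∀ c, c ≠ D.circle α (Sum.inl (j, 0)) → c ≠ D.circle α (Sum.inl (j, 2)) →
          b (π c) = a c := by
        constructor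
        · rintro ⟨-, -, h⟩ c
          obtain ⟨q, rfl⟩ := circle_surjective α c
          rw [hπ]
          exact h q
        · exact fun h => ⟨hv.1, hv.2, fun q => hπ q ▸ h (D.circle α q)⟩
      simp only [edgeBlock, edgeMatrix, edgeCoeff, Matrix.of_apply, hiff, if_pos hm, hπ]
      split_ifs
      · rfl
      · simp
    have hsum : ∀ e a, (labelEval (D.Circle β) * D.edgeBlock j α β) e a =
        labelEval (D.Circle α) (fun c => e (π c)) a := fun e a => by
      rw [← sum_merge π hsurj _ _ hm.1 (by rw [hπ, hπ, hm.2]) hinj, Matrix.mul_apply]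
      exact Finset.sum_congr rfl fun b _ => by rw [hE]
    -- For a merge, both old circles receive the root of the new one, with factor `1`.
    refine retraction_mul_comm _ _ _ fun e => ⟨fun c => e (π c), 1, congrArg e (hπ p), fun a => ?_⟩
    rw [hsum, hsum, one_mul, one_mul]
    exact ⟨rfl, rfl⟩
  by_cases hs : D.circle α (Sum.inl (j, 0)) = D.circle α (Sum.inl (j, 2)) ∧
      D.circle β (Sum.inl (j, 0)) ≠ D.circle β (Sum.inl (j, 2))
  · obtain ⟨π, hsurj, hπ, hinj⟩ := exists_circle_map hag' hs.1
    have hE : ∀ b a, D.edgeBlock j α β b a =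
        if ∀ c, c ≠ D.circle β (Sum.inl (j, 0)) → c ≠ D.circle β (Sum.inl (j, 2)) →
          b c = a (π c) then
        bnComul (a (π (D.circle β (Sum.inl (j, 0))))) (b (D.circle β (Sum.inl (j, 0))))
          (b (D.circle β (Sum.inl (j, 2)))) else 0 := by
      intro b a
      have hiff : (α j = false ∧ β = Function.update α j true ∧
          ∀ p : D.Point, D.circle α p ≠ D.circle α (Sum.inl (j, 0)) →
            D.circle α p ≠ D.circle α (Sum.inl (j, 2)) →
            b (D.circle β p) = a (D.circle α p)) ↔
          ∀ c, c ≠ D.circle β (Sum.inl (j, 0)) → c ≠ D.circle β (Sum.inl (j, 2)) →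
          b c = a (π c) := by
        constructor
        · rintro ⟨-, -, h⟩ c h0 h2
          obtain ⟨q, rfl⟩ := circle_surjective β c
          rw [hπ]
          have ht : ¬ D.Touches α j q := fun ht => (ht.of_agree hag).elim h0 h2
          exact h q (fun e => ht (Or.inl e)) fun e => ht (Or.inr e)
        · refine fun h => ⟨hv.1, hv.2, fun q h0 h2 => ?_⟩
          have ht : ¬ D.Touches β j q := fun ht => (ht.of_agree hag').elim h0 h2
          rw [h _ (fun e => ht (Or.inl e)) fun e => ht (Or.inr e), hπ]
      simp only [edgeBlock, edgeMatrix, edgeCoeff, Matrix.of_apply, hiff, if_neg hm, if_pos hs, hπ]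
      split_ifs
      · rfl
      · simp
    have hsum : ∀ e a, (labelEval (D.Circle β) * D.edgeBlock j α β) e a =
        (if e (D.circle β (Sum.inl (j, 0))) = e (D.circle β (Sum.inl (j, 2))) then X else 0) *
          labelEval (D.Circle α) (fun d => e (Function.surjInv hsurj d)) a := fun e a => by
      rw [← sum_split π hsurj _ _ hs.2 (by rw [hπ, hπ, hs.1]) hinj, Matrix.mul_apply]
      exact Finset.sum_congr rfl fun b _ => by rw [hE]
    refine retraction_mul_comm _ _ _ fun e => ?_
    by_cases he : e (D.circle β (Sum.inl (j, 0))) = e (D.circle β (Sum.inl (j, 2)))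
    · refine ⟨fun d => e (Function.surjInv hsurj d), X, ?_, fun a => ?_⟩
      -- The section may miss the circle through `p`, but then it picks the other new circle, which
      -- carries the same root.
      · have hq : π (Function.surjInv hsurj (D.circle α p)) = π (D.circle β p) :=
          (Function.surjInv_eq hsurj _).trans (hπ p).symm
        rcases hinj _ _ hq with h | ⟨h | h, h' | h'⟩
        · exact congrArg e h
        all_goals simp only [h, h', he]
      · rw [hsum, hsum, if_pos he, if_pos (by rw [he])]
        exact ⟨rfl, rfl⟩
    -- With different roots on the two new circles both evaluations vanish, so any choice of roots
    -- with the right value at the basepoint works.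
    · refine ⟨fun _ => e (D.circle β p), 0, rfl, fun a => ?_⟩
      rw [hsum, hsum, if_neg he, if_neg fun h => he (Bool.not_inj h)]
      simp
  · apply hzero
    ext1 b a
    simp only [edgeBlock, edgeMatrix, edgeCoeff, Matrix.of_apply, Matrix.zero_apply, if_neg hm,
      if_neg hs]
    simp

/-- The retraction of the whole Bar-Natan complex onto `C_x`. -/
noncomputable def retractionMatrix (p : D.Point) : Matrix D.State D.State (ZMod 2)[X] :=
  Matrix.blockDiagonal' fun α => retraction (D.circle α p)

theorem retractionMatrix_mul_edgeMatrix (p : D.Point) (j : Fin D.n) :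
    D.retractionMatrix p * D.edgeMatrix j = D.edgeMatrix j * D.retractionMatrix p := by
  ext1 ⟨β, b⟩ ⟨α, a⟩
  have h := congrFun (congrFun (D.retraction_mul_edgeBlock p j α β) b) a
  rw [Matrix.mul_apply, Matrix.mul_apply] at h
  rw [Matrix.mul_apply, Matrix.mul_apply, Fintype.sum_sigma, Fintype.sum_sigma,
    Fintype.sum_eq_single β, Fintype.sum_eq_single α]
  · simp only [retractionMatrix, Matrix.blockDiagonal'_apply_eq]
    exact h
  · intro γ hγ
    simp only [retractionMatrix, Matrix.blockDiagonal'_apply_ne _ _ _ hγ, mul_zero,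
      Finset.sum_const_zero]
  · intro γ hγ
    simp only [retractionMatrix, Matrix.blockDiagonal'_apply_ne _ _ _ hγ.symm, zero_mul,
      Finset.sum_const_zero]

/-- The matrix of `d + H h` on all states. -/
noncomputable def diffMatrix : Matrix D.State D.State (ZMod 2)[X] :=
  Matrix.of fun t s => C (D.dCoeff s t) + X * C (D.hCoeff s t)

theorem diffMatrix_eq_sum : D.diffMatrix = ∑ j, D.edgeMatrix j := by
  ext1 t s
  simp only [diffMatrix, edgeMatrix, dCoeff, hCoeff, Matrix.sum_apply, Matrix.of_apply, map_sum,
    Finset.sum_add_distrib, Finset.mul_sum]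

theorem retractionMatrix_mul_diffMatrix (p : D.Point) :
    D.retractionMatrix p * D.diffMatrix = D.diffMatrix * D.retractionMatrix p := by
  rw [diffMatrix_eq_sum, Finset.mul_sum, Finset.sum_mul]
  exact Finset.sum_congr rfl fun j _ => D.retractionMatrix_mul_edgeMatrix p j

theorem retractionMatrix_apply_of_fst_ne (p : D.Point) {t s : D.State} (h : t.1 ≠ s.1) :
    D.retractionMatrix p t s = 0 :=
  Matrix.blockDiagonal'_apply_ne _ _ _ h

theorem retractionMatrix_apply_of_ne (p : D.Point) {t : D.State}
    (ht : t.2 (D.circle t.1 p) ≠ Label.x) (s : D.State) : D.retractionMatrix p t s = 0 := by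
  obtain ⟨β, b⟩ := t
  obtain ⟨α, a⟩ := s
  by_cases h : β = α
  · subst h
    exact (Matrix.blockDiagonal'_apply_eq _ _ _ _).trans (retraction_apply_of_ne _ ht a)
  · exact D.retractionMatrix_apply_of_fst_ne p h

theorem retractionMatrix_apply_of_eq (p : D.Point) {s : D.State}
    (hs : s.2 (D.circle s.1 p) = Label.x) (t : D.State) :
    D.retractionMatrix p t s = (1 : Matrix D.State D.State (ZMod 2)[X]) t s := by
  obtain ⟨β, b⟩ := t
  obtain ⟨α, a⟩ := s
  by_cases h : β = α
  · subst h
    refine (Matrix.blockDiagonal'_apply_eq _ _ _ _).trans ((retraction_apply_of_eq _ hs b).trans ?_)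
    simp only [Matrix.one_apply, Sigma.mk.injEq, heq_eq_eq, true_and]
  · rw [D.retractionMatrix_apply_of_fst_ne p h, Matrix.one_apply_ne fun e => h (congrArg Sigma.fst e)]

/-! ### The splitting of the Bar-Natan complex. -/

/-- The retraction onto `C_x` in degree `i`. -/
noncomputable def chainRetraction (p : D.Point) (i : ℤ) : D.Chain i →ₗ[(ZMod 2)[X]] D.Chain i :=
  Matrix.mulVecLin (Matrix.of fun t s : D.Gen i => D.retractionMatrix p t.1 s.1)

theorem chainRetraction_mem (p : D.Point) (i : ℤ) (v : D.Chain i) :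
    D.chainRetraction p i v ∈ D.Part p Label.x i := fun _ ht =>
  Finset.sum_eq_zero fun s _ =>
    (congrArg (· * v s) (D.retractionMatrix_apply_of_ne p ht s.1)).trans (zero_mul _)

theorem chainRetraction_of_mem (p : D.Point) (i : ℤ) {v : D.Chain i}
    (hv : v ∈ D.Part p Label.x i) : D.chainRetraction p i v = v := by
  funext t
  have h : D.chainRetraction p i v t = ∑ s, D.retractionMatrix p t.1 s.1 * v s := rfl
  rw [h, Fintype.sum_eq_single t]
  · by_cases ht : t.1.2 (D.circle t.1.1 p) = Label.x
    · rw [D.retractionMatrix_apply_of_eq p ht, Matrix.one_apply_eq, one_mul]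
    · rw [hv t ht, mul_zero]
  · intro s hs
    by_cases h : s.1.2 (D.circle s.1.1 p) = Label.x
    · rw [D.retractionMatrix_apply_of_eq p h,
        Matrix.one_apply_ne fun e => hs (Subtype.ext e.symm), zero_mul]
    · rw [hv s h, mul_zero]

theorem chainRetraction_diff (p : D.Point) (i j : ℤ) (v : D.Chain i) :
    D.chainRetraction p j (D.diff i j v) = D.diff i j (D.chainRetraction p i v) := by
  simp only [chainRetraction, diff, Matrix.mulVecLin_apply, Matrix.mulVec_mulVec]
  congr 1
  ext1 t s
  have h := congrFun (congrFun (D.retractionMatrix_mul_diffMatrix p) t.1) s.1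
  rw [Matrix.mul_apply, Matrix.mul_apply] at h ⊢
  -- The retraction preserves the vertex of the cube, hence the degree, so both sums extend by zero
  -- to all states.
  refine Eq.trans (Fintype.sum_of_injective (Subtype.val : D.Gen j → D.State) Subtype.val_injective _
      (fun u => D.retractionMatrix p t.1 u * D.diffMatrix u s.1) ?_ fun _ => rfl) (h.trans
    (Fintype.sum_of_injective (Subtype.val : D.Gen i → D.State) Subtype.val_injective _
      (fun u => D.diffMatrix t.1 u * D.retractionMatrix p u s.1) ?_ fun _ => rfl).symm)
  · intro u hu
    rw [D.retractionMatrix_apply_of_fst_ne p fun e => hu ⟨⟨u, e ▸ t.2⟩, rfl⟩, zero_mul]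
  · intro u hu
    rw [D.retractionMatrix_apply_of_fst_ne p fun e => hu ⟨⟨u, e.symm ▸ s.2⟩, rfl⟩, mul_zero]

theorem proj_of_mem (p : D.Point) (a : Label) (i : ℤ) {v : D.Chain i} (hv : v ∈ D.Part p a i) :
    D.proj p a i v = ⟨v, hv⟩ := by
  ext1
  funext s
  by_cases h : s.1.2 (D.circle s.1.1 p) = a
  · exact if_pos h
  · exact (if_neg h).trans (hv s h).symm

theorem proj_one_eq_zero_iff (p : D.Point) (i : ℤ) (v : D.Chain i) :
    D.proj p Label.one i v = 0 ↔ v ∈ D.Part p Label.x i := by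
  constructor
  · intro h s hs
    have h1 : s.1.2 (D.circle s.1.1 p) = Label.one := by
      cases e : s.1.2 (D.circle s.1.1 p)
      · rfl
      · exact absurd e hs
    have h2 := congrFun (congrArg Subtype.val h) s
    exact (if_pos h1).symm.trans h2
  · intro h
    ext1
    funext s
    by_cases h1 : s.1.2 (D.circle s.1.1 p) = Label.one
    · exact (if_pos h1).trans (h s (by rw [h1]; decide))
    · exact if_neg h1

/-- The Bar-Natan chain group as the direct sum of `C_x` and `C_1`, compatibly with the
differentials. -/
noncomputable def splitting (p : D.Point) (i : ℤ) :
    D.Chain i ≃ₗ[(ZMod 2)[X]] D.Part p Label.x i × D.Part p Label.one i :=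
  LinearEquiv.ofBijective
    (((D.chainRetraction p i).codRestrict _ (D.chainRetraction_mem p i)).prod
      (D.proj p Label.one i)) <| by
    constructor
    · rw [injective_iff_map_eq_zero]
      intro v hv
      have h1 : D.chainRetraction p i v = 0 := congrArg (fun w => (w.1 : D.Chain i)) hv
      have h2 : D.proj p Label.one i v = 0 := congrArg Prod.snd hv
      rw [← h1, D.chainRetraction_of_mem p i ((D.proj_one_eq_zero_iff p i v).mp h2)]
    · rintro ⟨w, z⟩
      have hw : w.1 - D.chainRetraction p i z.1 ∈ D.Part p Label.x i :=
        Submodule.sub_mem _ w.2 (D.chainRetraction_mem p i z.1)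
      -- Adding an element of `C_x` to `z` leaves its `C_1`-part alone; this one corrects the
      -- retraction of `z` to `w`.
      refine ⟨w.1 - D.chainRetraction p i z.1 + z.1, Prod.ext (Subtype.ext ?_) ?_⟩
      · change D.chainRetraction p i _ = _
        rw [map_add, D.chainRetraction_of_mem p i hw, sub_add_cancel]
      · change D.proj p Label.one i _ = _
        rw [map_add, (D.proj_one_eq_zero_iff p i _).mpr hw, D.proj_of_mem _ _ _ z.2, zero_add]

theorem splitting_diff (p : D.Point) (i j : ℤ) (v : D.Chain i) :
    D.splitting p j (D.diff i j v) = (D.redDiff p Label.x i j (D.splitting p i v).1,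
      D.redDiff p Label.one i j (D.splitting p i v).2) := by
  refine Prod.ext (Subtype.ext ?_) ?_
  · change D.chainRetraction p j (D.diff i j v) =
      (D.proj p Label.x j (D.diff i j (D.chainRetraction p i v))).1
    rw [D.proj_of_mem _ _ _ (D.diff_mem_part_x p i j _ (D.chainRetraction_mem p i v)),
      chainRetraction_diff]
  · change D.proj p Label.one j (D.diff i j v) =
      D.proj p Label.one j (D.diff i j (D.proj p Label.one i v).1)
    -- A chain and its `C_1`-part differ by an element of `C_x`, which the differential preserves.
    rw [← sub_eq_zero, ← map_sub, ← map_sub, proj_one_eq_zero_iff]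
    apply diff_mem_part_x
    rw [← proj_one_eq_zero_iff, map_sub, D.proj_of_mem _ _ _ (D.proj p Label.one i v).2, sub_self]

end LinkDiagram

theorem mainTheorem1 (D : LinkDiagram) (p : D.Point) (i : ℤ) :
    Nonempty (D.BN i ≃ₗ[Polynomial (ZMod 2)] (D.RedBN p Label.x i × D.RedBN p Label.one i)) :=
  nonempty_middleHomology_prod (D.splitting p (i - 1)) (D.splitting p i) (D.splitting p (i + 1))
    (D.splitting_diff p (i - 1) i) (D.splitting_diff p i (i + 1))
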